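/- Let $\mathcal{L}(s)=\sum_{n\ge1}a(n)n^{-s}$ be a Dirichlet series, absolutely convergent for $\Re s>1$, and denote its meromorphic continuation by the same letter. Consider the following axioms. (1) $a(n)\ll_\varepsilon n^\varepsilon$ for every $\varepsilon>0$. (2) There is an integer $k\ge0$ such that $(s-1)^k\mathcal{L}(s)$ is an entire function of finite order. (3) There are an integer $f\ge0$, reals $Q>0$, $\lambda_j>0$ and complex numbers $\mu_j,\omega$ with $\Re\mu_j\ge0$ $(1\le j\le f)$ and $|\omega|=1$ such that $\Lambda(s)=\mathcal{L}(s)Q^s\prod_{j=1}^f\Gamma(\lambda_js+\mu_j)$ satisfies $\Lambda(s)=\omega\overline{\Lambda(1-\bar s)}$. (4) (Polynomial Euler product of order $m\ge1$.) There are $\alpha_j(p)\in\mathbb{C}$ for primes $p$ and $1\le j\le m$ such that $\mathcal{L}(s)=\prod_p\prod_{j=1}^m(1-\alpha_j(p)p^{-s})^{-1}$ for $\Re s>1$, the product converging absolutely. (4') There are complex numbers $b(p^k)$ for primes $p$ and $k\geq 1$ and a $0\le\theta<1/2$ with $b(p^k)\ll p^{k\theta}$ such that $\mathcal{L}(s)=\prod_p\exp\bigl(\sum_{k\ge1}b(p^k)p^{-ks}\bigr)$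 for $\Re s>1$. (6) There is $c>0$ such that $\mathcal{L}$ has no zeros in $\{z:\Re z\ge1-c/\log(|\Im z|+2)\}$, except possibly one real zero. (7) With $\mu^*(\sigma)=\inf\{\lambda>0:\mathcal{L}(\sigma+it)\ll_\sigma|t|^\lambda\}$, one has $\mu^*(\sigma)\ll1-2\sigma$ uniformly for $\sigma<0$. The Selberg class $\mathcal{S}$ is defined by (1), (2), (3), (4'); the class $\mathcal{SP}$ by (1), (2), (3), (4); and the Dixit–Mahatab class $\mathcal{G}$ by $a(1)=1$ and (1), (2), (4), (6), (7). For a positive integer $\alpha$, let $d_\alpha(n)$ be the number of ways to write $n$ as an ordered product of $\alpha$ positive integers, so $d_1(n)=1$. For $\ell>0$, the growth axiom with exponent $\ell$ is the bound $\mathcal{L}(1+it)\ll(\log|t|)^\ell$ as $|t|\to\infty$, with an implied constant that may depend on $\mathcal{L}$ and $\ell$. **Theorem.** (a) If $\mathcal{L}\in\mathcal{G}$ has a polynomial Euler product of order $m$ and $\varepsilon>0$, then $\mathcal{L}$ satisfies the growth axiom with $\ell=m+\varepsilon$. (b) If $\mathcal{L}\in\mathcal{S}$ and $a(n)\ll d_\alpha(n)$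 for some positive integer $\alpha$, then $\mathcal{L}$ satisfies the growth axiom with $\ell=\alpha$. (c) If $\mathcal{L}\in\mathcal{SP}$ has a polynomial Euler product of order $m$, then $\mathcal{L}$ satisfies the growth axiom with $\ell=m$. -/

import Mathlib

open Filter Asymptotics Topology Complex

/-!
Throughout, a Dirichlet series is given by its coefficients `a : ℕ → ℂ` (the value `a 0` is
irrelevant) together with a function `L : ℂ → ℂ`, its meromorphic continuation. The only possible
pole of `L` is `1`, and the value of the Lean function `L` at the point `1` is never used.
-/

/-- `L` is represented, for `Re s > 1`, by the absolutely convergent series `∑_{n ≥ 1} a n / n ^ s`. -/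
def IsDirichletSeries (a : ℕ → ℂ) (L : ℂ → ℂ) : Prop :=
  ∀ s : ℂ, 1 < s.re → LSeriesHasSum a s (L s)

/-- Ramanujan hypothesis: `a n ≪_ε n ^ ε` for every `ε > 0`. -/
def RamanujanHypothesis (a : ℕ → ℂ) : Prop :=
  ∀ ε : ℝ, 0 < ε → a =O[atTop] (fun n : ℕ => (n : ℝ) ^ ε)

/-- An entire function of finite order: `g s ≪ exp (|s| ^ ρ)` for some real `ρ`. -/
def IsEntireOfFiniteOrder (g : ℂ → ℂ) : Prop :=
  Differentiable ℂ g ∧ ∃ ρ : ℝ, g =O[cocompact ℂ] (fun s : ℂ => Real.exp (‖s‖ ^ ρ))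

/-- Analytic continuation: for some integer `k ≥ 0`, the function `(s - 1) ^ k * L s` is
(after removing the singularity at `1`) entire of finite order. -/
def HasAnalyticContinuation (L : ℂ → ℂ) : Prop :=
  ∃ (k : ℕ) (g : ℂ → ℂ), IsEntireOfFiniteOrder g ∧ ∀ s : ℂ, s ≠ 1 → g s = (s - 1) ^ k * L s

/-- `Λ(s) = L(s) Q^s ∏_j Γ(lam_j s + μ_j)`. -/
noncomputable def completedL (L : ℂ → ℂ) (Q : ℝ) {f : ℕ} (lam : Fin f → ℝ) (μ : Fin f → ℂ)
    (s : ℂ) : ℂ :=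
  L s * (Q : ℂ) ^ s * ∏ j, Complex.Gamma ((lam j : ℂ) * s + μ j)

/-- No Gamma factor of `completedL` has a pole at `s`. -/
def GammaFactorsRegular {f : ℕ} (lam : Fin f → ℝ) (μ : Fin f → ℂ) (s : ℂ) : Prop :=
  ∀ (j : Fin f) (n : ℕ), (lam j : ℂ) * s + μ j ≠ -(n : ℂ)

/-- Functional equation `Λ(s) = ω * conj (Λ(1 - conj s))`. It is an identity of meromorphic functions;
it is required at all points at which every factor on either side is regular. -/
def HasFunctionalEquation (L : ℂ → ℂ) : Prop :=
  ∃ (f : ℕ) (Q : ℝ) (lam : Fin f → ℝ) (μ : Fin f → ℂ) (ω : ℂ),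
    0 < Q ∧ (∀ j, 0 < lam j) ∧ (∀ j, 0 ≤ (μ j).re) ∧ ‖ω‖ = 1 ∧
    ∀ s : ℂ, s ≠ 0 → s ≠ 1 → GammaFactorsRegular lam μ s →
      GammaFactorsRegular lam μ (1 - (starRingEnd ℂ) s) →
      completedL L Q lam μ s =
        ω * (starRingEnd ℂ) (completedL L Q lam μ (1 - (starRingEnd ℂ) s))

/-- Polynomial Euler product of order `m`: there are `α_j(p)` such that, for `Re s > 1`,
`L(s) = ∏_p ∏_{j ≤ m} (1 - α_j(p) / p ^ s)⁻¹`, the product being absolutely convergent. -/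
def HasPolynomialEulerProduct (L : ℂ → ℂ) (m : ℕ) : Prop :=
  1 ≤ m ∧ ∃ α : Nat.Primes → Fin m → ℂ, ∀ s : ℂ, 1 < s.re →
    Summable (fun p : Nat.Primes => ∑ j, ‖α p j / ((p : ℕ) : ℂ) ^ s‖) ∧
    HasProd (fun p : Nat.Primes => ∏ j, (1 - α p j / ((p : ℕ) : ℂ) ^ s)⁻¹) (L s)

/-- Euler product of the Selberg class: for `Re s > 1`,
`L(s) = ∏_p exp (∑_{k ≥ 1} b(p ^ k) / p ^ (k s))`, where `b(p ^ k) ≪ p ^ (k θ)` for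
some `0 ≤ θ < 1 / 2`. -/
def HasSelbergEulerProduct (L : ℂ → ℂ) : Prop :=
  ∃ (b : ℕ → ℂ) (θ C : ℝ), 0 ≤ θ ∧ θ < 1 / 2 ∧
    (∀ (p : Nat.Primes) (k : ℕ), 1 ≤ k →
      ‖b ((p : ℕ) ^ k)‖ ≤ C * ((p : ℕ) : ℝ) ^ ((k : ℝ) * θ)) ∧
    ∀ s : ℂ, 1 < s.re →
      HasProd (fun p : Nat.Primes =>
        Complex.exp (∑' k : ℕ, b ((p : ℕ) ^ (k + 1)) / ((p : ℕ) : ℂ) ^ (((k : ℂ) + 1) * s))) (L s)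

/-- Zero-free region: for some `c > 0`, `L` has no zeros with
`Re z ≥ 1 - c / log (|Im z| + 2)`, except possibly one real (Siegel) zero `β`.
A zero is a point where the meromorphic function `L` has positive order. -/
def HasZeroFreeRegion (L : ℂ → ℂ) : Prop :=
  ∃ c : ℝ, 0 < c ∧ ∃ β : ℝ, ∀ z : ℂ, 1 - c / Real.log (|z.im| + 2) ≤ z.re →
    0 < meromorphicOrderAt L z → z = (β : ℂ)

/-- `μ*(σ) = inf {κ > 0 : L(σ + it) ≪_σ |t| ^ κ as |t| → ∞}`, equal to `∞` if there is
no such `κ`. -/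
noncomputable def muStar (L : ℂ → ℂ) (σ : ℝ) : ENNReal :=
  sInf {x : ENNReal | ∃ κ : ℝ, 0 < κ ∧ x = ENNReal.ofReal κ ∧
    (fun t : ℝ => L ((σ : ℂ) + (t : ℂ) * I)) =O[cocompact ℝ] (fun t : ℝ => |t| ^ κ)}

/-- Growth condition: `μ*(σ) ≪ 1 - 2 σ` uniformly for `σ < 0`. -/
def HasGrowthCondition (L : ℂ → ℂ) : Prop :=
  ∃ C : ℝ, ∀ σ : ℝ, σ < 0 → muStar L σ ≤ ENNReal.ofReal (C * (1 - 2 * σ))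

/-- The Selberg class `𝒮`. -/
structure InSelbergClass (a : ℕ → ℂ) (L : ℂ → ℂ) : Prop where
  dirichletSeries : IsDirichletSeries a L
  ramanujan : RamanujanHypothesis a
  continuation : HasAnalyticContinuation L
  functionalEquation : HasFunctionalEquation L
  eulerProduct : HasSelbergEulerProduct L

/-- The Selberg class `𝒮𝒫` of functions with a polynomial Euler product, of order `m`. -/
structure InSelbergClassPoly (a : ℕ → ℂ) (L : ℂ → ℂ) (m : ℕ) : Prop where
  dirichletSeries : IsDirichletSeries a L
  ramanujan : RamanujanHypothesis a
  continuation : HasAnalyticContinuation L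
  functionalEquation : HasFunctionalEquation L
  eulerProduct : HasPolynomialEulerProduct L m

/-- The Dixit–Mahatab class `𝒢`, with polynomial Euler product of order `m`. In presence of
the Euler product the Ramanujan hypothesis says exactly that all `|α_j(p)| ≤ 1`, equivalently
that the coefficients of `log L` at prime powers are bounded by `m`. -/
structure InClassG (a : ℕ → ℂ) (L : ℂ → ℂ) (m : ℕ) : Prop where
  dirichletSeries : IsDirichletSeries a L
  coeff_one : a 1 = 1
  ramanujan : RamanujanHypothesis a
  continuation : HasAnalyticContinuation L
  eulerProduct : HasPolynomialEulerProduct L m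
  zeroFree : HasZeroFreeRegion L
  growth : HasGrowthCondition L

/-- `d_α(n)`: the number of ways to write `n` as an ordered product of `α` positive integers. -/
def generalDivisor (α n : ℕ) : ℕ :=
  (Nat.finMulAntidiag α n).card

/-- Growth on the 1-line with exponent `ℓ > 0`: `L(1 + it) ≪ (log |t|) ^ ℓ` as `|t| → ∞`. -/
def GrowthOnOneLine (L : ℂ → ℂ) (ℓ : ℝ) : Prop :=
  0 < ℓ ∧ (fun t : ℝ => L (1 + (t : ℂ) * I)) =O[cocompact ℝ] (fun t : ℝ => Real.log |t| ^ ℓ)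

/-! The proof interpolates between two vertical lines. If the coefficients are dominated by `C *
d_α(n)`, comparison with the Dirichlet series of `ζ ^ α` gives `‖L(1 + δ + it)‖ ≤ C ζ(1 + δ) ^ α ≪ δ
^ (-α)`, uniformly in `t`. On `Re s = -1` there is polynomial growth, either from the growth
condition or from the functional equation and a bound for quotients of Gamma functions. Finite order
permits Phragmén-Lindelöf in between. With `δ = 1 / log |t|`, a power of `|t|` large enough to
absorb the left edge costs only a constant on the right edge, so `(log |t|) ^ α` survives at `1 +
it` (`growthOnOneLine_of_bounds`).

For a polynomial Euler product the coefficient bound has to be derived. The local series `∑ a(p ^ k)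
X ^ k` is the inverse of `∏ (1 - α_j(p) X)`, and the Ramanujan hypothesis makes it converge for `|X|
< 1`. The polynomial thus has no root in the open unit disc, so `|α_j(p)| ≤ 1`
(`norm_le_one_of_ramanujanHypothesis`). Then `a` is a convolution of `m` functions bounded by `1`,
whence `|a(n)| ≤ d_m(n)`. -/

/-! ### Preliminary growth estimates -/

/-- A function bounded by a polynomial outside a compact set and continuous is bounded by a
polynomial everywhere. -/
theorem Continuous.exists_norm_le_one_add_abs_pow {f : ℝ → ℂ} (hf : Continuous f) {κ : ℝ}
    (h : f =O[cocompact ℝ] fun t : ℝ => |t| ^ κ) :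
    ∃ (C : ℝ) (N : ℕ), 0 ≤ C ∧ ∀ t, ‖f t‖ ≤ C * (1 + |t|) ^ N := by
  obtain ⟨N, hN⟩ := exists_nat_ge κ
  obtain ⟨c, hc, hb⟩ := h.exists_nonneg
  have hev := hb.bound
  have h1 : ∀ᶠ t : ℝ in cocompact ℝ, 1 ≤ ‖t‖ := tendsto_norm_cocompact_atTop.eventually_ge_atTop 1
  obtain ⟨K, hK, hKs⟩ := mem_cocompact.1 (hev.and h1)
  obtain ⟨M, hM⟩ := hK.exists_bound_of_continuousOn hf.continuousOn
  refine ⟨max c M, N, le_max_of_le_left hc, fun t => ?_⟩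
  have hone : (1 : ℝ) ≤ (1 + |t|) ^ N := one_le_pow₀ (by linarith [abs_nonneg t])
  by_cases ht : t ∈ K
  · calc ‖f t‖ ≤ M := hM t ht
      _ ≤ max c M := le_max_right _ _
      _ ≤ max c M * (1 + |t|) ^ N := le_mul_of_one_le_right (le_max_of_le_left hc) hone
  · obtain ⟨h2, h3⟩ := hKs ht
    rw [Real.norm_eq_abs] at h3
    calc ‖f t‖ ≤ c * ‖|t| ^ κ‖ := h2
      _ = c * |t| ^ κ := by rw [Real.norm_of_nonneg (by positivity)]
      _ ≤ c * |t| ^ (N : ℝ) := by gcongr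
      _ ≤ max c M * (1 + |t|) ^ N := by
        rw [Real.rpow_natCast]
        gcongr
        · exact le_max_left _ _
        · linarith

/-- The Gaussian decay of the interpolation kernel absorbs polynomial growth in the distance from
height `t`. -/
theorem exists_one_add_pow_mul_exp_neg_sq_le (N : ℕ) :
    ∃ K : ℝ, 0 ≤ K ∧ ∀ v : ℝ, 0 ≤ v → (1 + v) ^ N * Real.exp (-v ^ 2) ≤ K := by
  refine ⟨N.factorial * Real.exp 2, by positivity, fun v hv => ?_⟩
  have h1 : (1 + v) ^ N / N.factorial ≤ Real.exp (1 + v) := Real.pow_div_factorial_le_exp _ (by linarith) N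
  rw [div_le_iff₀ (by positivity)] at h1
  calc (1 + v) ^ N * Real.exp (-v ^ 2) ≤ Real.exp (1 + v) * N.factorial * Real.exp (-v ^ 2) := by gcongr
    _ = N.factorial * Real.exp (1 + v - v ^ 2) := by
      rw [sub_eq_add_neg (1 + v), Real.exp_add (1 + v)]; ring
    _ ≤ N.factorial * Real.exp 2 := by
      gcongr
      nlinarith [sq_nonneg (v - 1)]

theorem norm_exp_sq_add_mul (t B : ℝ) (w : ℂ) :
    ‖exp ((w - 1 - t * I) ^ 2 + B * (w - 1))‖ =
      Real.exp ((w.re - 1) ^ 2 - (w.im - t) ^ 2 + B * (w.re - 1)) := by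
  rw [norm_exp]
  congr 1
  simp [pow_two]

/-- Growth of an entire function of finite order in a strip, in the form used by the
Phragmén-Lindelöf principle. -/
theorem IsEntireOfFiniteOrder.isBigO_strip {g : ℂ → ℂ} (hg : IsEntireOfFiniteOrder g) (a b : ℝ) :
    g =O[comap (_root_.abs ∘ im) atTop ⊓ 𝓟 (re ⁻¹' Set.Ioo a b)]
      fun z => Real.exp (1 * Real.exp (1 * |z.im|)) := by
  obtain ⟨-, ρ, hρ⟩ := hg
  have htend : Tendsto (fun z : ℂ => |z.im|) (comap (_root_.abs ∘ im) atTop ⊓ 𝓟 (re ⁻¹' Set.Ioo a b))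
      atTop := tendsto_comap.mono_left inf_le_left
  have hco : comap (_root_.abs ∘ im) atTop ⊓ 𝓟 (re ⁻¹' Set.Ioo a b) ≤ cocompact ℂ := by
    rw [← Metric.cobounded_eq_cocompact, ← comap_norm_atTop, ← tendsto_iff_comap]
    exact tendsto_atTop_mono (fun z => abs_im_le_norm z) htend
  refine (hρ.mono hco).trans (IsBigO.of_bound 1 ?_)
  obtain ⟨N, hN⟩ := exists_nat_ge ρ
  have hsmall : ∀ᶠ x : ℝ in atTop, (2 * x) ^ N ≤ Real.exp x := by
    have h := (Real.isLittleO_pow_exp_atTop (n := N)).const_mul_left ((2 : ℝ) ^ N)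
    filter_upwards [h.bound one_pos, eventually_ge_atTop 0] with x hx hx0
    rw [Real.norm_of_nonneg (by positivity), Real.norm_of_nonneg (by positivity)] at hx
    rw [mul_pow]
    linarith
  have hmem : ∀ᶠ z : ℂ in comap (_root_.abs ∘ im) atTop ⊓ 𝓟 (re ⁻¹' Set.Ioo a b),
      z ∈ re ⁻¹' Set.Ioo a b := mem_inf_of_right (mem_principal_self _)
  filter_upwards [htend.eventually hsmall, htend.eventually_ge_atTop (max 1 (|a| + |b|)), hmem]
    with z hz hz1 hz2
  have hre : |z.re| ≤ |a| + |b| := by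
    have := hz2.1; have := hz2.2
    rw [abs_le]
    constructor <;> linarith [neg_abs_le a, le_abs_self b, abs_nonneg a, abs_nonneg b]
  have hone : 1 ≤ ‖z‖ := (le_max_left _ _).trans (hz1.trans (abs_im_le_norm z))
  have hnorm : ‖z‖ ≤ 2 * |z.im| := by
    have := norm_le_abs_re_add_abs_im z
    have := (le_max_right _ _).trans hz1
    linarith
  rw [Real.norm_of_nonneg (by positivity), Real.norm_of_nonneg (by positivity), one_mul, one_mul,
    one_mul]
  gcongr
  calc ‖z‖ ^ ρ ≤ ‖z‖ ^ (N : ℝ) := by gcongr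
    _ = ‖z‖ ^ N := Real.rpow_natCast _ _
    _ ≤ (2 * |z.im|) ^ N := by gcongr
    _ ≤ Real.exp |z.im| := hz

/-! ### Interpolation by Phragmén-Lindelöf -/

/-- Convexity: a bound `δ ^ (-ℓ)` on the lines `Re s = 1 + δ` and polynomial growth on the line
`Re s = -1` give a bound `(log |t|) ^ ℓ` on the line `Re s = 1`. -/
theorem growthOnOneLine_of_bounds {L : ℂ → ℂ} {ℓ : ℝ} (hℓ : 0 < ℓ)
    (hcont : HasAnalyticContinuation L)
    (hleft : ∃ κ : ℝ, (fun t : ℝ => L (((-1 : ℝ) : ℂ) + (t : ℂ) * I)) =O[cocompact ℝ]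
      fun t : ℝ => |t| ^ κ)
    (hright : ∃ C : ℝ, ∀ δ : ℝ, 0 < δ → δ ≤ 1 → ∀ s : ℂ, s.re = 1 + δ → ‖L s‖ ≤ C * δ ^ (-ℓ)) :
    GrowthOnOneLine L ℓ := by
  refine ⟨hℓ, ?_⟩
  obtain ⟨k, g, hg, hgL⟩ := hcont
  obtain ⟨κ, hκ⟩ := hleft
  obtain ⟨C, hC⟩ := hright
  have hC0 : 0 ≤ C := by
    have := (norm_nonneg _).trans (hC 1 one_pos le_rfl 2 (by norm_num))
    simpa using this
  have hne2 : ∀ w : ℂ, -1 ≤ w.re → w + 2 ≠ 0 := fun w hw h => by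
    have := congrArg re h
    simp at this
    linarith
  have hone_le : ∀ w : ℂ, -1 ≤ w.re → 1 ≤ ‖w + 2‖ := fun w hw => by
    have := re_le_norm (w + 2)
    simp at this
    linarith
  -- The factor `(w - 1) ^ k` in `g` removes the pole; dividing by `(w + 2) ^ k`, nonzero for `Re w
  -- ≥ -1`, removes its growth, so `G` stays comparable to `L`.
  set G : ℂ → ℂ := fun w => g w / (w + 2) ^ k with hG
  have hGL : ∀ w : ℂ, -1 ≤ w.re → w ≠ 1 → ‖G w‖ ≤ 4 ^ k * ‖L w‖ := fun w hw hw1 => by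
    have h1 := hone_le w hw
    have h2 : ‖w - 1‖ ≤ 4 * ‖w + 2‖ := by
      have : ‖w - 1‖ ≤ ‖w + 2‖ + ‖(3 : ℂ)‖ := by
        rw [show w - 1 = w + 2 - 3 by ring]
        exact norm_sub_le _ _
      have h3 : ‖(3 : ℂ)‖ = 3 := by norm_num
      linarith
    simp only [hG]
    rw [hgL w hw1, norm_div, norm_mul, norm_pow, norm_pow, div_le_iff₀ (by positivity)]
    calc ‖w - 1‖ ^ k * ‖L w‖ ≤ (4 * ‖w + 2‖) ^ k * ‖L w‖ := by gcongr
      _ = 4 ^ k * ‖L w‖ * ‖w + 2‖ ^ k := by ring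
  have hGdiff : ∀ w : ℂ, -1 ≤ w.re → DifferentiableAt ℂ G w := fun w hw =>
    (hg.1 w).div (by fun_prop) (pow_ne_zero _ (hne2 w hw))
  -- the bound on the left line
  obtain ⟨C1, N, hC1, hleftG⟩ : ∃ (C : ℝ) (N : ℕ), 0 ≤ C ∧
      ∀ t : ℝ, ‖G (((-1 : ℝ) : ℂ) + (t : ℂ) * I)‖ ≤ C * (1 + |t|) ^ N := by
    refine Continuous.exists_norm_le_one_add_abs_pow (κ := κ) ?_ (IsBigO.trans ?_ hκ)
    · refine continuous_iff_continuousAt.2 fun t => ?_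
      exact ContinuousAt.comp (f := fun t : ℝ => (((-1 : ℝ) : ℂ) + (t : ℂ) * I)) (g := G)
        (hGdiff _ (by simp)).continuousAt (by fun_prop)
    · refine IsBigO.of_bound (4 ^ k) (Eventually.of_forall fun t => hGL _ (by simp) fun h => ?_)
      have := congrArg re h
      norm_num at this
  obtain ⟨K, hK, hKb⟩ := exists_one_add_pow_mul_exp_neg_sq_le N
  -- The two entries are the bounds obtained on the left and right edges.
  set M : ℝ := max (C1 * K * Real.exp 4 * 2 ^ N) (4 ^ k * C * Real.exp (1 + N)) with hM
  have hM0 : 0 ≤ M := le_max_of_le_left (by positivity)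
  refine IsBigO.of_bound (4 ^ k * M) ?_
  have hlarge : ∀ᶠ t : ℝ in cocompact ℝ, Real.exp 1 ≤ ‖t‖ :=
    tendsto_norm_cocompact_atTop.eventually_ge_atTop _
  filter_upwards [hlarge] with t ht
  rw [Real.norm_eq_abs] at ht
  set T := |t| with hT
  have hT1 : 1 ≤ T := le_trans (Real.one_le_exp zero_le_one) ht
  have hT0 : 0 < T := by linarith
  have hlog1 : 1 ≤ Real.log T := (Real.le_log_iff_exp_le hT0).2 ht
  set lT := Real.log T with hlT
  have hlog0 : 0 < lT := by linarith
  set δ := lT⁻¹ with hδ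
  have hδ0 : 0 < δ := inv_pos.2 hlog0
  have hδ1 : δ ≤ 1 := inv_le_one_of_one_le₀ hlog1
  have hδℓ : δ ^ (-ℓ) = lT ^ ℓ := by
    rw [hδ, Real.inv_rpow hlog0.le, Real.rpow_neg hlog0.le, inv_inv]
  have hpow1 : 1 ≤ lT ^ ℓ := Real.one_le_rpow hlog1 hℓ.le
  -- The kernel is `1` at `1 + it`. Its quadratic part localizes near height `t`; its linear part
  -- has size `T ^ (-2N)` at `Re w = -1` but only `exp N` at `Re w = 1 + δ`, since `δ * log T = 1`.
  set E : ℂ → ℂ := fun w => exp ((w - 1 - t * I) ^ 2 + (N * lT : ℝ) * (w - 1)) with hE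
  have hEn : ∀ w, ‖E w‖ = Real.exp ((w.re - 1) ^ 2 - (w.im - t) ^ 2 + (N * lT : ℝ) * (w.re - 1)) :=
    fun w => norm_exp_sq_add_mul t _ w
  have hEdiff : Differentiable ℂ E := by
    simp only [hE]; fun_prop
  set H : ℂ → ℂ := fun w => G w * E w with hH
  have key : ‖H (1 + t * I)‖ ≤ M * lT ^ ℓ := by
    refine PhragmenLindelof.vertical_strip (f := H) (a := -1) (b := 1 + δ) ?_ ?_ ?_ ?_ ?_ ?_
    · refine DifferentiableOn.diffContOnCl fun w hw => ?_
      have hw' : -1 ≤ w.re := by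
        have : closure (re ⁻¹' Set.Ioo (-1 : ℝ) (1 + δ)) ⊆ {w : ℂ | -1 ≤ w.re} :=
          closure_minimal (fun w hw => hw.1.le) (isClosed_le continuous_const continuous_re)
        exact this hw
      exact ((hGdiff w hw').mul (hEdiff w)).differentiableWithinAt
    -- The strip has width `2 + δ ≤ 3 < π`, so the growth exponent `1` is admissible.
    · refine ⟨1, ?_, 1, ?_⟩
      · rw [lt_div_iff₀ (by linarith)]
        linarith [Real.pi_gt_three]
      · refine IsBigO.trans ?_ (hg.isBigO_strip (-1) (1 + δ))
        refine IsBigO.of_bound (Real.exp (4 + N * lT)) ?_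
        have hmem : ∀ᶠ z : ℂ in comap (_root_.abs ∘ im) atTop ⊓ 𝓟 (re ⁻¹' Set.Ioo (-1) (1 + δ)),
          z ∈ re ⁻¹' Set.Ioo (-1) (1 + δ) := mem_inf_of_right (mem_principal_self _)
        filter_upwards [hmem] with z hz
        have hz1 : -1 < z.re := hz.1
        have hz2 : z.re < 1 + δ := hz.2
        have hG' : ‖G z‖ ≤ ‖g z‖ := by
          simp only [hG]
          rw [norm_div, norm_pow]
          exact div_le_self (norm_nonneg _) (one_le_pow₀ (hone_le z hz1.le))
        have hE' : ‖E z‖ ≤ Real.exp (4 + N * lT) := by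
          rw [hEn]
          have h5 : (N * lT : ℝ) * (z.re - 1) ≤ N * lT * 1 := by exact mul_le_mul_of_nonneg_left (by linarith) (by positivity)
          have h6 : (z.re - 1) ^ 2 ≤ 4 := by nlinarith
          refine Real.exp_le_exp.2 ?_
          nlinarith [sq_nonneg (z.im - t)]
        simp only [hH]
        rw [norm_mul, mul_comm]
        gcongr
    · intro z hz
      have hzeq : z = ((-1 : ℝ) : ℂ) + (z.im : ℂ) * I := by
        rw [← hz]; exact (re_add_im z).symm
      have h1 : ‖G z‖ ≤ C1 * (1 + |z.im|) ^ N := by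
        have := hleftG z.im
        rwa [← hzeq] at this
      have h2 : 1 + |z.im| ≤ (2 * T) * (1 + |z.im - t|) := by
        have h3 : |z.im| ≤ |z.im - t| + T := by
          simpa using abs_add_le (z.im - t) t
        nlinarith [abs_nonneg (z.im - t)]
      have h4 : ‖E z‖ = Real.exp 4 * Real.exp (-|z.im - t| ^ 2) * (T ^ (2 * N))⁻¹ := by
        have h5 : (T ^ (2 * N))⁻¹ = Real.exp (N * lT * (-1 - 1)) := by
          rw [← Real.exp_log (pow_pos hT0 (2 * N)), ← Real.exp_neg, Real.log_pow]
          push_cast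
          congr 1; ring
        rw [hEn, hz, h5, ← Real.exp_add, ← Real.exp_add, sq_abs]
        congr 1; ring
      calc ‖H z‖ = ‖G z‖ * ‖E z‖ := norm_mul _ _
        _ ≤ (C1 * (2 * T * (1 + |z.im - t|)) ^ N) *
            (Real.exp 4 * Real.exp (-|z.im - t| ^ 2) * (T ^ (2 * N))⁻¹) := by
          rw [h4]
          gcongr
          exact h1.trans (by gcongr)
        _ = C1 * Real.exp 4 * 2 ^ N * (T ^ N * (T ^ (2 * N))⁻¹) *
            ((1 + |z.im - t|) ^ N * Real.exp (-|z.im - t| ^ 2)) := by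
          rw [mul_pow, mul_pow]; ring
        _ ≤ C1 * Real.exp 4 * 2 ^ N * 1 * K := by
          gcongr
          · rw [← div_eq_mul_inv]
            exact div_le_one_of_le₀ (pow_le_pow_right₀ hT1 (by omega)) (by positivity)
          · exact hKb _ (abs_nonneg _)
        _ = C1 * K * Real.exp 4 * 2 ^ N := by ring
        _ ≤ M := le_max_left _ _
        _ ≤ M * lT ^ ℓ := le_mul_of_one_le_right hM0 hpow1
    · intro z hz
      have hz1 : z ≠ 1 := fun h => by
        rw [h] at hz
        simp at hz
        exact hδ0.ne' hz
      have h1 := hGL z (by linarith) hz1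
      have h2 := hC δ hδ0 hδ1 z hz
      have h3 : ‖E z‖ ≤ Real.exp (1 + N) := by
        rw [hEn, hz]
        have h4 : (N * lT : ℝ) * (1 + δ - 1) = N := by
          rw [hδ]; field_simp; ring
        rw [h4]
        gcongr
        nlinarith [sq_nonneg (z.im - t)]
      calc ‖H z‖ = ‖G z‖ * ‖E z‖ := norm_mul _ _
        _ ≤ (4 ^ k * (C * δ ^ (-ℓ))) * Real.exp (1 + N) := by
          gcongr
          exact h1.trans (by gcongr)
        _ = 4 ^ k * C * Real.exp (1 + N) * lT ^ ℓ := by rw [hδℓ]; ring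
        _ ≤ M * lT ^ ℓ := by gcongr; exact le_max_right _ _
    · simp
    · simp [hδ0.le]
  have hE1 : ‖E (1 + t * I)‖ = 1 := by
    rw [hEn]; simp
  have hne1 : (1 + t * I : ℂ) ≠ 1 := fun h => by
    have := congrArg im h
    simp at this
    rw [this] at hT
    simp at hT
    linarith
  have hH1 : ‖H (1 + t * I)‖ = ‖L (1 + t * I)‖ * (‖(t * I : ℂ)‖ / ‖(1 + t * I + 2 : ℂ)‖) ^ k := by
    simp only [hH, hG]
    rw [norm_mul, hE1, hgL _ hne1, norm_div, norm_mul, norm_pow, norm_pow, add_sub_cancel_left,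
      div_pow]
    ring
  -- Passing from `G` back to `L` at `1 + it` costs a factor at most `4 ^ k`.
  have hquart : (4 : ℝ)⁻¹ ≤ ‖(t * I : ℂ)‖ / ‖(1 + t * I + 2 : ℂ)‖ := by
    have h1 : ‖(t * I : ℂ)‖ = T := by simp [hT]
    have h2 : ‖(1 + t * I + 2 : ℂ)‖ ≤ 3 + T := by
      calc ‖(1 + t * I + 2 : ℂ)‖ = ‖(3 : ℂ) + t * I‖ := by ring_nf
        _ ≤ ‖(3 : ℂ)‖ + ‖(t * I : ℂ)‖ := norm_add_le _ _
        _ = 3 + T := by rw [h1]; norm_num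
    have h3 := hone_le (1 + t * I) (by simp)
    rw [h1, le_div_iff₀ (by linarith)]
    linarith
  rw [Real.norm_of_nonneg (by positivity), mul_assoc]
  have h5 : ‖L (1 + t * I)‖ * (4 : ℝ)⁻¹ ^ k ≤ M * lT ^ ℓ := by
    refine le_trans ?_ (hH1 ▸ key)
    gcongr
  rw [inv_pow, ← div_eq_mul_inv, div_le_iff₀ (by positivity)] at h5
  linarith

/-! ### Gamma quotients and growth on the left line -/

/-- On vertical lines, the Beta integral is bounded. -/
theorem norm_betaIntegral_le (z : ℂ) (d : ℝ) :
    ‖betaIntegral z d‖ ≤ ∫ x in (0 : ℝ)..1, x ^ (z.re - 1) * (1 - x) ^ (d - 1) := by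
  refine (intervalIntegral.norm_integral_le_integral_norm zero_le_one).trans (le_of_eq ?_)
  refine intervalIntegral.integral_congr_ae ?_
  -- At `x = 1` the base `1 - x` vanishes and the norm formula for powers of positive reals is not
  -- available.
  have h1 : ∀ᵐ x : ℝ, x ≠ 1 := MeasureTheory.Measure.ae_ne _ _
  filter_upwards [h1] with x hx1 hx
  rw [Set.uIoc_of_le zero_le_one] at hx
  have hx' : 0 < 1 - x := sub_pos.2 (lt_of_le_of_ne hx.2 hx1)
  rw [norm_mul, norm_cpow_eq_rpow_re_of_pos hx.1]
  congr 1
  rw [← ofReal_one, ← ofReal_sub, norm_cpow_eq_rpow_re_of_pos hx']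
  simp

/-- On a fixed vertical line, `Γ` is dominated by its right translates. -/
theorem exists_norm_Gamma_le_norm_Gamma_add {x d : ℝ} (hx : 0 < x) (hd : 0 < d) :
    ∃ C : ℝ, 0 ≤ C ∧ ∀ z : ℂ, z.re = x → ‖Gamma z‖ ≤ C * ‖Gamma (z + d)‖ := by
  refine ⟨(∫ u in (0 : ℝ)..1, u ^ (x - 1) * (1 - u) ^ (d - 1)) / ‖Gamma (d : ℂ)‖, ?_, ?_⟩
  · refine div_nonneg (intervalIntegral.integral_nonneg zero_le_one fun u hu => ?_) (norm_nonneg _)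
    have := hu.1
    have : 0 ≤ 1 - u := by linarith [hu.2]
    positivity
  · intro z hz
    have hG : 0 < ‖Gamma (d : ℂ)‖ := norm_pos_iff.2 (Gamma_ne_zero_of_re_pos (by simpa using hd))
    have h := Gamma_mul_Gamma_eq_betaIntegral (s := z) (t := d) (by rw [hz]; exact hx)
      (by simpa using hd)
    have h2 := norm_betaIntegral_le z d
    rw [hz] at h2
    rw [div_mul_eq_mul_div, le_div_iff₀ hG, ← norm_mul, h, norm_mul, mul_comm]
    gcongr

theorem norm_Gamma_add_natCast_le {z : ℂ} (hz : z.im ≠ 0) (N : ℕ) :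
    ‖Gamma (z + N)‖ ≤ (‖z‖ + N) ^ N * ‖Gamma z‖ := by
  suffices h : ∀ n ≤ N, ‖Gamma (z + n)‖ ≤ (‖z‖ + N) ^ n * ‖Gamma z‖ from h N le_rfl
  intro n
  induction n with
  | zero => simp
  | succ n ih =>
    intro hn
    have hne : z + n ≠ 0 := fun h => hz (by simpa using congrArg im h)
    have h1 : ‖z + n‖ ≤ ‖z‖ + N := by
      refine (norm_add_le _ _).trans ?_
      have : (n : ℝ) ≤ N := by exact_mod_cast (by omega : n ≤ N)
      simpa using this
    rw [Nat.cast_succ, ← add_assoc, Gamma_add_one _ hne, norm_mul, pow_succ']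
    calc ‖z + n‖ * ‖Gamma (z + n)‖ ≤ (‖z‖ + N) * ((‖z‖ + N) ^ n * ‖Gamma z‖) := by
          gcongr
          exact ih (by omega)
      _ = _ := by ring

/-- Polynomial bound for a quotient of Gamma functions on vertical lines. -/
theorem exists_norm_Gamma_le_pow_mul {l : ℝ} (hl : 0 < l) {μ : ℂ} (hμ : 0 ≤ μ.re) :
    ∃ (C : ℝ) (N : ℕ), 0 ≤ C ∧ ∀ t : ℝ, l * t + μ.im ≠ 0 → 1 ≤ |t| →
      ‖Gamma ((l : ℂ) * (2 + t * I) + μ)‖ ≤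
        C * |t| ^ N * ‖Gamma ((l : ℂ) * (-1 + t * I) + μ)‖ := by
  -- The arguments on the two lines differ by `3 * l`. Shifting the right one by a further `N - 3 *
  -- l > 0` makes the total shift the integer `N`, which the recursion `Γ(z + 1) = z Γ(z)` handles.
  obtain ⟨N, hN⟩ := exists_nat_gt (3 * l)
  obtain ⟨C, hC, hCb⟩ := exists_norm_Gamma_le_norm_Gamma_add (x := 2 * l + μ.re) (d := N - 3 * l)
    (by linarith) (by linarith)
  refine ⟨C * (2 * l + ‖μ‖ + N) ^ N, N, by positivity, fun t ht ht1 => ?_⟩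
  set z : ℂ := (l : ℂ) * (-1 + t * I) + μ with hz
  have hzim : z.im ≠ 0 := by simpa [hz] using ht
  have hzn : ‖z‖ + N ≤ (2 * l + ‖μ‖ + N) * |t| := by
    have h1 : ‖z‖ ≤ l * (1 + |t|) + ‖μ‖ := by
      refine (norm_add_le _ _).trans ?_
      rw [norm_mul, norm_real, Real.norm_of_nonneg hl.le]
      gcongr
      refine (norm_add_le _ _).trans ?_
      simp
    have h2 : (0 : ℝ) ≤ N := N.cast_nonneg
    nlinarith [norm_nonneg μ]
  have h1 := hCb ((l : ℂ) * (2 + t * I) + μ) (by simp; ring)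
  have h2 : (l : ℂ) * (2 + t * I) + μ + ((N - 3 * l : ℝ) : ℂ) = z + N := by
    rw [hz]; push_cast; ring
  rw [h2] at h1
  calc _ ≤ C * ‖Gamma (z + N)‖ := h1
    _ ≤ C * ((‖z‖ + N) ^ N * ‖Gamma z‖) := by gcongr; exact norm_Gamma_add_natCast_le hzim N
    _ ≤ C * (((2 * l + ‖μ‖ + N) * |t|) ^ N * ‖Gamma z‖) := by gcongr
    _ = _ := by rw [mul_pow]; ring

theorem exists_norm_prod_Gamma_le {f : ℕ} {lam : Fin f → ℝ} {μ : Fin f → ℂ}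
    (hlam : ∀ j, 0 < lam j) (hμ : ∀ j, 0 ≤ (μ j).re) :
    ∃ (C : ℝ) (N : ℕ), 0 ≤ C ∧ ∀ t : ℝ, (∀ j, lam j * t + (μ j).im ≠ 0) → 1 ≤ |t| →
      ‖∏ j, Gamma ((lam j : ℂ) * (2 + t * I) + μ j)‖ ≤
        C * |t| ^ N * ‖∏ j, Gamma ((lam j : ℂ) * (-1 + t * I) + μ j)‖ := by
  choose C N hC h using fun j => exists_norm_Gamma_le_pow_mul (hlam j) (hμ j)
  refine ⟨∏ j, C j, ∑ j, N j, Finset.prod_nonneg fun j _ => hC j, fun t ht ht1 => ?_⟩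
  rw [norm_prod, norm_prod, ← Finset.prod_pow_eq_pow_sum, ← Finset.prod_mul_distrib,
    ← Finset.prod_mul_distrib]
  exact Finset.prod_le_prod (fun j _ => norm_nonneg _) fun j _ => h j t (ht j) ht1

/-- The functional equation gives polynomial growth on the line `Re s = -1`. -/
theorem HasFunctionalEquation.isBigO_left_line {L : ℂ → ℂ} (h : HasFunctionalEquation L)
    (hb : ∃ B : ℝ, ∀ s : ℂ, s.re = 2 → ‖L s‖ ≤ B) :
    ∃ κ : ℝ, (fun t : ℝ => L (((-1 : ℝ) : ℂ) + (t : ℂ) * I)) =O[cocompact ℝ]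
      fun t : ℝ => |t| ^ κ := by
  obtain ⟨f, Q, lam, μ, ω, hQ, hlam, hμ, hω, hFE⟩ := h
  obtain ⟨B, hB⟩ := hb
  obtain ⟨C, N, hC, hGb⟩ := exists_norm_prod_Gamma_le hlam hμ
  -- `Q ^ 3` is the quotient of `Q ^ 2` by `Q ^ (-1)` in the reflected equation.
  refine ⟨N, IsBigO.of_bound (B * Q ^ 3 * C) ?_⟩
  -- Poles of the Gamma factors lie at finitely many heights, so both sides are regular for large
  -- `|t|`.
  have hlarge : ∀ᶠ t : ℝ in cocompact ℝ, ∀ j, lam j * t + (μ j).im ≠ 0 := by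
    rw [eventually_all]
    intro j
    filter_upwards [tendsto_norm_cocompact_atTop.eventually_gt_atTop (|(μ j).im| / lam j)]
      with t ht h0
    rw [div_lt_iff₀ (hlam j), Real.norm_eq_abs, mul_comm, ← abs_of_pos (hlam j), ← abs_mul,
      eq_neg_of_add_eq_zero_left h0, abs_neg] at ht
    exact lt_irrefl _ ht
  filter_upwards [hlarge, tendsto_norm_cocompact_atTop.eventually_ge_atTop 1] with t ht ht1
  rw [Real.norm_eq_abs] at ht1
  have hreg : ∀ x : ℝ, GammaFactorsRegular lam μ (x + t * I) := fun x j n h => by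
    refine ht j ?_
    simpa using congrArg im h
  set s : ℂ := -1 + t * I with hs
  have hs1 : (((-1 : ℝ) : ℂ) + (t : ℂ) * I) = s := by simp [hs]
  have hrefl : 1 - (starRingEnd ℂ) s = 2 + t * I := by
    simp [hs]; ring
  have hre : s.re = -1 := by simp [hs]
  have h := hFE s (fun h => by norm_num [h] at hre) (fun h => by norm_num [h] at hre)
    (by simpa [hs] using hreg (-1)) (by simpa [hrefl] using hreg 2)
  rw [hrefl] at h
  have hn := congrArg norm h
  have hP : ∏ j, Gamma ((lam j : ℂ) * s + μ j) ≠ 0 :=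
    Finset.prod_ne_zero_iff.2 fun j _ => Gamma_ne_zero fun n =>
      (by simpa [hs] using hreg (-1) : GammaFactorsRegular lam μ s) j n
  have hP' := norm_pos_iff.2 hP
  simp only [completedL] at hn
  rw [norm_mul, norm_mul, norm_mul, RCLike.norm_conj, norm_mul, norm_mul, hω, one_mul,
    norm_cpow_eq_rpow_re_of_pos hQ, norm_cpow_eq_rpow_re_of_pos hQ] at hn
  have hQ1 : Q ^ s.re = Q⁻¹ := by
    rw [hre, Real.rpow_neg_one]
  have hQ2 : Q ^ (2 + t * I : ℂ).re = Q ^ 2 := by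
    have : (2 + t * I : ℂ).re = (2 : ℕ) := by simp
    rw [this, Real.rpow_natCast]
  rw [hQ1, hQ2] at hn
  have hB0 : 0 ≤ B := (norm_nonneg _).trans (hB 2 (by simp))
  rw [hs1, Real.rpow_natCast, norm_pow, Real.norm_eq_abs, abs_abs]
  refine le_of_mul_le_mul_right ?_ hP'
  calc ‖L s‖ * ‖∏ j, Gamma ((lam j : ℂ) * s + μ j)‖
      = Q * (‖L s‖ * Q⁻¹ * ‖∏ j, Gamma ((lam j : ℂ) * s + μ j)‖) := by
        rw [mul_right_comm, mul_comm Q, inv_mul_cancel_right₀ hQ.ne']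
    _ = Q * (‖L (2 + t * I)‖ * Q ^ 2 * ‖∏ j, Gamma ((lam j : ℂ) * (2 + t * I) + μ j)‖) := by
      rw [hn]
    _ ≤ Q * (B * Q ^ 2 * (C * |t| ^ N * ‖∏ j, Gamma ((lam j : ℂ) * s + μ j)‖)) := by
      gcongr
      · exact hB _ (by simp)
      · exact hGb t ht ht1
    _ = _ := by ring

/-- Finiteness of `muStar L (-1)` already provides an admissible exponent. -/
theorem HasGrowthCondition.isBigO_left_line {L : ℂ → ℂ} (h : HasGrowthCondition L) :
    ∃ κ : ℝ, (fun t : ℝ => L (((-1 : ℝ) : ℂ) + (t : ℂ) * I)) =O[cocompact ℝ]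
      fun t : ℝ => |t| ^ κ := by
  obtain ⟨C, hC⟩ := h
  have h1 := (hC (-1) (by norm_num)).trans_lt ENNReal.ofReal_lt_top
  obtain ⟨x, ⟨κ, -, -, hκ⟩, -⟩ := sInf_lt_iff.1 h1
  exact ⟨κ, hκ⟩

/-! ### Divisor functions and comparison with powers of zeta -/

theorem generalDivisor_zero (n : ℕ) : generalDivisor 0 n = if n = 1 then 1 else 0 := by
  split_ifs with h
  · simp [generalDivisor, h, Nat.finMulAntidiag_one]
  · simp [generalDivisor, Nat.finMulAntidiag_zero_left h]

/-- Recursion for the generalized divisor functions: `d_{α+1} = 1 * d_α`. -/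
theorem generalDivisor_succ (α n : ℕ) :
    generalDivisor (α + 1) n = ∑ p ∈ n.divisorsAntidiagonal, generalDivisor α p.2 := by
  simp only [generalDivisor]
  rw [← Finset.card_sigma]
  -- A factorization is split into its first factor and its tail, indexed by the product of the
  -- tail.
  refine Finset.card_nbij' (fun f => ⟨(f 0, ∏ i : Fin α, f i.succ), Fin.tail f⟩)
    (fun x => Fin.cons x.1.1 x.2) ?_ ?_ ?_ ?_
  · intro f hf
    simp only [Finset.mem_coe, Nat.mem_finMulAntidiag, Fin.prod_univ_succ] at hf
    simp only [Finset.coe_sigma, Set.mem_sigma_iff, Finset.mem_coe, Nat.mem_divisorsAntidiagonal,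
      Nat.mem_finMulAntidiag, Fin.tail]
    refine ⟨hf, trivial, fun h => hf.2 ?_⟩
    rw [← hf.1, h, mul_zero]
  · rintro ⟨⟨x, y⟩, f⟩ h
    simp only [Finset.coe_sigma, Set.mem_sigma_iff, Finset.mem_coe, Nat.mem_divisorsAntidiagonal,
      Nat.mem_finMulAntidiag] at h
    simp only [Finset.mem_coe, Nat.mem_finMulAntidiag, Fin.prod_univ_succ, Fin.cons_zero,
      Fin.cons_succ]
    rw [h.2.1]
    exact h.1
  · intro f _
    exact Fin.cons_self_tail f
  · rintro ⟨⟨x, y⟩, f⟩ h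
    simp only [Finset.coe_sigma, Set.mem_sigma_iff, Finset.mem_coe, Nat.mem_divisorsAntidiagonal,
      Nat.mem_finMulAntidiag] at h
    simp [h.2.1]

theorem LSeriesHasSum_generalDivisor (α : ℕ) {s : ℂ} (hs : 1 < s.re) :
    LSeriesHasSum (fun n => (generalDivisor α n : ℂ)) s (riemannZeta s ^ α) := by
  induction α with
  | zero =>
    have h := hasSum_single (f := LSeries.term (fun n => (generalDivisor 0 n : ℂ)) s) 1
      fun n hn => by
        rcases eq_or_ne n 0 with rfl | hn0
        · simp
        · simp [LSeries.term_of_ne_zero hn0, generalDivisor_zero, hn]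
    simpa [LSeriesHasSum, LSeries.term_of_ne_zero, generalDivisor_zero] using h
  | succ α ih =>
    rw [pow_succ']
    convert (LSeriesHasSum_one hs).convolution ih using 1
    ext n
    simp [LSeries.convolution_def, generalDivisor_succ]

/-- The simple pole makes `(s - 1) * ζ(s)`, completed by its residue `1`, continuous and hence
bounded on the segment `[1, 2]`. -/
theorem exists_norm_riemannZeta_le :
    ∃ C : ℝ, 0 ≤ C ∧ ∀ δ : ℝ, 0 < δ → δ ≤ 1 → ‖riemannZeta ((1 + δ : ℝ) : ℂ)‖ ≤ C * δ⁻¹ := by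
  have hdiff : Continuous (Function.update (fun s : ℂ => (s - 1) * riemannZeta s) 1 1) := by
    rw [continuous_iff_continuousAt]
    intro s
    rcases eq_or_ne s 1 with rfl | hs
    · exact continuousAt_update_same.2 riemannZeta_residue_one
    · refine (continuousAt_update_of_ne hs).2 ?_
      exact ((continuousAt_id.sub continuousAt_const)).mul (differentiableAt_riemannZeta hs).continuousAt
  obtain ⟨C, hC⟩ := (isCompact_Icc (a := (0 : ℝ)) (b := 1)).exists_bound_of_continuousOn
    (f := fun δ : ℝ => Function.update (fun s : ℂ => (s - 1) * riemannZeta s) 1 1 ((1 + δ : ℝ) : ℂ))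
    (hdiff.comp (by fun_prop)).continuousOn
  refine ⟨C, (norm_nonneg _).trans (hC 0 (by simp)), fun δ h0 h1 => ?_⟩
  have h := hC δ ⟨h0.le, h1⟩
  have hne : ((1 + δ : ℝ) : ℂ) ≠ 1 := by
    norm_cast
    linarith
  rw [Function.update_of_ne hne, norm_mul] at h
  have h2 : ‖((1 + δ : ℝ) : ℂ) - 1‖ = δ := by
    rw [ofReal_add, ofReal_one, add_sub_cancel_left, norm_real, Real.norm_of_nonneg h0.le]
  rw [h2] at h
  rw [← div_eq_mul_inv, le_div_iff₀ h0]
  linarith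

theorem norm_le_of_coeff_le_generalDivisor {a : ℕ → ℂ} {L : ℂ → ℂ} (hL : IsDirichletSeries a L)
    {α : ℕ} {C : ℝ} (hC : ∀ n : ℕ, 1 ≤ n → ‖a n‖ ≤ C * (generalDivisor α n : ℝ))
    {s : ℂ} (hs : 1 < s.re) : ‖L s‖ ≤ C * ‖riemannZeta (s.re : ℂ)‖ ^ α := by
  have hC0 : 0 ≤ C := by
    have := (norm_nonneg _).trans (hC 1 le_rfl)
    simpa [generalDivisor, Nat.finMulAntidiag_one] using this
  have h1 := LSeriesHasSum_generalDivisor α (s := (s.re : ℂ)) (by simpa using hs)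
  have h2 := (Complex.hasSum_re h1).mul_left C
  have h3 := tsum_of_norm_bounded (f := LSeries.term a s) h2 fun n => ?_
  · rw [(hL s hs).tsum_eq] at h3
    refine h3.trans ?_
    gcongr
    exact (re_le_norm _).trans (norm_pow _ _).le
  · rcases eq_or_ne n 0 with rfl | hn
    · simp
    · have h4 : LSeries.term (fun n => (generalDivisor α n : ℂ)) (s.re : ℂ) n =
          ((generalDivisor α n / (n : ℝ) ^ s.re : ℝ) : ℂ) := by
        rw [LSeries.term_of_ne_zero hn, ofReal_div, ofReal_cpow n.cast_nonneg]
        simp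
      rw [h4, ofReal_re, LSeries.norm_term_eq, if_neg hn, mul_div_assoc']
      gcongr
      exact hC n (Nat.one_le_iff_ne_zero.2 hn)

/-- A Dirichlet series with coefficients `O(d_α(n))`, with finite order and polynomial growth on
`Re s = -1`, is `O((log |t|) ^ α)` on the line `Re s = 1`. -/
theorem growthOnOneLine_of_coeff_le_generalDivisor {a : ℕ → ℂ} {L : ℂ → ℂ}
    (hL : IsDirichletSeries a L) (hcont : HasAnalyticContinuation L) {α : ℕ} (hα : 1 ≤ α)
    {C : ℝ} (hC : ∀ n : ℕ, 1 ≤ n → ‖a n‖ ≤ C * (generalDivisor α n : ℝ))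
    (hleft : (∃ B : ℝ, ∀ s : ℂ, s.re = 2 → ‖L s‖ ≤ B) →
      ∃ κ : ℝ, (fun t : ℝ => L (((-1 : ℝ) : ℂ) + (t : ℂ) * I)) =O[cocompact ℝ]
        fun t : ℝ => |t| ^ κ) :
    GrowthOnOneLine L α := by
  have hC0 : 0 ≤ C := by
    have := (norm_nonneg _).trans (hC 1 le_rfl)
    simpa [generalDivisor, Nat.finMulAntidiag_one] using this
  -- The premise of `hleft` is boundedness on `Re s = 2`, the reflection of `Re s = -1`.
  refine growthOnOneLine_of_bounds (by exact_mod_cast hα) hcont (hleft ?_) ?_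
  · refine ⟨C * ‖riemannZeta ((2 : ℝ) : ℂ)‖ ^ α, fun s hs => ?_⟩
    have := norm_le_of_coeff_le_generalDivisor hL hC (s := s) (by rw [hs]; norm_num)
    rwa [hs] at this
  · obtain ⟨Z, hZ, hZb⟩ := exists_norm_riemannZeta_le
    refine ⟨C * Z ^ α, fun δ h0 h1 s hs => ?_⟩
    have := norm_le_of_coeff_le_generalDivisor hL hC (s := s) (by rw [hs]; linarith)
    rw [hs] at this
    rw [Real.rpow_neg h0.le, Real.rpow_natCast, ← inv_pow, mul_assoc, ← mul_pow]
    refine this.trans ?_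
    gcongr
    exact hZb δ h0 h1

/-! ### Completely multiplicative factors of an Euler product -/

/-- The completely multiplicative function with prescribed values at the primes. -/
noncomputable def completelyMultiplicative (α : Nat.Primes → ℂ) : ℕ →*₀ ℂ where
  toFun n := if n = 0 then 0 else
    n.factorization.prod fun p e => (if h : p.Prime then α ⟨p, h⟩ else 0) ^ e
  map_zero' := by simp
  map_one' := by simp
  map_mul' m n := by
    rcases eq_or_ne m 0 with rfl | hm
    · simp
    rcases eq_or_ne n 0 with rfl | hn
    · simp
    simp only [mul_eq_zero, hm, hn, or_self, if_false]
    rw [Nat.factorization_mul hm hn, Finsupp.prod_add_index']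
    · simp
    · intro p e₁ e₂
      exact pow_add _ _ _

theorem completelyMultiplicative_prime (α : Nat.Primes → ℂ) (p : Nat.Primes) :
    completelyMultiplicative α p = α p := by
  have h : completelyMultiplicative α p = if (p : ℕ) = 0 then 0 else
    (p : ℕ).factorization.prod fun p e => (if h : p.Prime then α ⟨p, h⟩ else 0) ^ e := rfl
  rw [h, if_neg p.2.ne_zero, p.2.factorization, Finsupp.prod_single_index (by simp), pow_one]
  exact dif_pos p.2

theorem norm_completelyMultiplicative_le {α : Nat.Primes → ℂ} {K : ℕ}
    (hα : ∀ p : Nat.Primes, ‖α p‖ ≤ ((p : ℕ) : ℝ) ^ K) (n : ℕ) :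
    ‖completelyMultiplicative α n‖ ≤ (n : ℝ) ^ K := by
  induction n using Nat.recOnMul with
  | zero => simp
  | one => simp
  | prime p hp => exact (completelyMultiplicative_prime α ⟨p, hp⟩).symm ▸ hα ⟨p, hp⟩
  | mul m n hm hn =>
    rw [map_mul, norm_mul, Nat.cast_mul, mul_pow]
    gcongr

theorem LSeriesSummable_completelyMultiplicative {α : Nat.Primes → ℂ} {K : ℕ}
    (hα : ∀ p : Nat.Primes, ‖α p‖ ≤ ((p : ℕ) : ℝ) ^ K) {s : ℂ} (hs : K + 1 < s.re) :
    LSeriesSummable (completelyMultiplicative α) s := by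
  refine LSeriesSummable_of_le_const_mul_rpow hs ⟨1, fun n _ => ?_⟩
  rw [one_mul, add_sub_cancel_right, Real.rpow_natCast]
  exact norm_completelyMultiplicative_le hα n

theorem hasProd_completelyMultiplicative {α : Nat.Primes → ℂ} {s : ℂ} (hs : s ≠ 0)
    (h : LSeriesSummable (completelyMultiplicative α) s) :
    HasProd (fun p : Nat.Primes => (1 - α p / ((p : ℕ) : ℂ) ^ s)⁻¹)
      (LSeries (completelyMultiplicative α) s) := by
  have hF : ∀ n, (completelyMultiplicative α * riemannZetaSummandHom hs) n =
      LSeries.term (completelyMultiplicative α) s n := fun n => by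
    rcases eq_or_ne n 0 with rfl | hn
    · simp
    · rw [LSeries.term_of_ne_zero hn, div_eq_mul_inv, ← cpow_neg]
      rfl
  have h1 := EulerProduct.eulerProduct_completely_multiplicative_hasProd
    (f := completelyMultiplicative α * riemannZetaSummandHom hs)
    (by simpa only [hF] using h.norm)
  simp only [hF] at h1
  rw [LSeries]
  convert h1 using 1
  ext p
  rw [LSeries.term_of_ne_zero p.2.ne_zero, completelyMultiplicative_prime]

/-- `completelyMultiplicative` as an arithmetic function. -/
noncomputable def completelyMultiplicativeAF (α : Nat.Primes → ℂ) : ArithmeticFunction ℂ :=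
  ⟨completelyMultiplicative α, map_zero _⟩

theorem LSeriesHasSum_prod {ι : Type*} (t : Finset ι) {F : ι → ArithmeticFunction ℂ} {s : ℂ}
    {A : ι → ℂ} (h : ∀ i ∈ t, LSeriesHasSum (F i) s (A i)) :
    LSeriesHasSum (∏ i ∈ t, F i : ArithmeticFunction ℂ) s (∏ i ∈ t, A i) := by
  classical
  induction t using Finset.induction_on with
  | empty =>
    rw [Finset.prod_empty, Finset.prod_empty, LSeriesHasSum]
    have h := hasSum_single (f := LSeries.term (1 : ArithmeticFunction ℂ) s) 1 fun n hn => by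
      rcases eq_or_ne n 0 with rfl | hn0
      · simp
      · simp [LSeries.term_of_ne_zero hn0, ArithmeticFunction.one_apply_ne hn]
    simpa [LSeries.term_of_ne_zero] using h
  | insert i t hi ih =>
    rw [Finset.prod_insert hi, Finset.prod_insert hi]
    exact ArithmeticFunction.LSeriesHasSum_mul (h i (Finset.mem_insert_self _ _))
      (ih fun j hj => h j (Finset.mem_insert_of_mem hj))

/-! ### Local series and the size of the local parameters -/

/-- The generating series of an arithmetic function along the powers of a prime. -/
noncomputable def primePowerSeries (p : Nat.Primes) : ArithmeticFunction ℂ →* PowerSeries ℂ where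
  toFun A := PowerSeries.mk fun k => A ((p : ℕ) ^ k)
  map_one' := by
    ext k
    rw [PowerSeries.coeff_mk, PowerSeries.coeff_one, ArithmeticFunction.one_apply]
    simp [p.2.ne_one]
  map_mul' A B := by
    ext k
    rw [PowerSeries.coeff_mk, PowerSeries.coeff_mul, ArithmeticFunction.mul_apply,
      Nat.sum_divisorsAntidiagonal (fun i j => A i * B j), Nat.sum_divisors_prime_pow p.2,
      Finset.Nat.sum_antidiagonal_eq_sum_range_succ_mk]
    refine Finset.sum_congr rfl fun i hi => ?_
    rw [PowerSeries.coeff_mk, PowerSeries.coeff_mk,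
      Nat.pow_div (by simpa [Nat.lt_succ_iff] using hi) p.2.pos]

theorem coeff_primePowerSeries (p : Nat.Primes) (A : ArithmeticFunction ℂ) (k : ℕ) :
    PowerSeries.coeff k (primePowerSeries p A) = A ((p : ℕ) ^ k) := by
  simp [primePowerSeries]

theorem primePowerSeries_completelyMultiplicativeAF_mul (α : Nat.Primes → ℂ) (p : Nat.Primes) :
    primePowerSeries p (completelyMultiplicativeAF α) *
      ((1 - Polynomial.C (α p) * Polynomial.X : Polynomial ℂ) : PowerSeries ℂ) = 1 := by
  have h : ∀ k, PowerSeries.coeff k (primePowerSeries p (completelyMultiplicativeAF α)) =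
      α p ^ k := fun k => by
    rw [coeff_primePowerSeries]
    change completelyMultiplicative α _ = _
    rw [map_pow, completelyMultiplicative_prime]
  ext k
  push_cast
  rw [mul_sub, mul_one, mul_left_comm, map_sub, PowerSeries.coeff_C_mul, PowerSeries.coeff_one]
  cases k with
  | zero => simp [h]
  | succ k => simp [h, PowerSeries.coeff_succ_mul_X, pow_succ']

/-- If a power series that converges absolutely at `x` is inverse to a polynomial `Q`, then
`Q x ≠ 0`. -/
theorem eval_ne_zero_of_powerSeries_mul_eq_one {A : PowerSeries ℂ} {Q : Polynomial ℂ}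
    (h : A * (Q : PowerSeries ℂ) = 1) {x : ℂ}
    (hx : Summable fun k => ‖PowerSeries.coeff k A * x ^ k‖) : Q.eval x ≠ 0 := by
  have hQs : HasSum (fun k => Q.coeff k * x ^ k) (Q.eval x) := by
    rw [Polynomial.eval_eq_sum_range]
    exact hasSum_sum_of_ne_finset_zero fun k hk => by
      rw [Polynomial.coeff_eq_zero_of_natDegree_lt (by simpa using hk), zero_mul]
  have hQn : Summable fun k => ‖Q.coeff k * x ^ k‖ := hQs.summable.norm
  -- By absolute convergence the formal identity evaluates through the Cauchy product, giving `A(x)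
  -- * Q(x) = 1`.
  have h1 := tsum_mul_tsum_eq_tsum_sum_antidiagonal_of_summable_norm hx hQn
  have h2 : ∀ n, ∑ kl ∈ Finset.HasAntidiagonal.antidiagonal n,
      PowerSeries.coeff kl.1 A * x ^ kl.1 * (Q.coeff kl.2 * x ^ kl.2) =
        if n = 0 then 1 else 0 := fun n => by
    have h3 : PowerSeries.coeff n (A * (Q : PowerSeries ℂ)) * x ^ n = if n = 0 then 1 else 0 := by
      rw [h, PowerSeries.coeff_one]
      split_ifs with hn <;> simp [hn]
    rw [← h3, PowerSeries.coeff_mul, Finset.sum_mul]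
    refine Finset.sum_congr rfl fun kl hkl => ?_
    rw [← Finset.HasAntidiagonal.mem_antidiagonal.1 hkl, Polynomial.coeff_coe, pow_add]
    ring
  intro h0
  rw [hQs.tsum_eq, h0, mul_zero] at h1
  simp_rw [h2] at h1
  simp at h1

theorem norm_prod_le_generalDivisor {m : ℕ} (F : Fin m → ArithmeticFunction ℂ)
    (hF : ∀ j n, n ≠ 0 → ‖F j n‖ ≤ 1) (n : ℕ) : ‖(∏ j, F j) n‖ ≤ generalDivisor m n := by
  induction m generalizing n with
  | zero =>
    rw [generalDivisor_zero, Finset.univ_eq_empty, Finset.prod_empty, ArithmeticFunction.one_apply]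
    split_ifs <;> simp
  | succ m ih =>
    rw [Fin.prod_univ_succ, generalDivisor_succ, ArithmeticFunction.mul_apply, Nat.cast_sum]
    refine (norm_sum_le _ _).trans (Finset.sum_le_sum fun x hx => ?_)
    rw [norm_mul]
    exact (mul_le_of_le_one_left (norm_nonneg _)
      (hF 0 _ (Nat.left_ne_zero_of_mem_divisorsAntidiagonal hx))).trans
        (ih (fun j => F j.succ) (fun j => hF j.succ) _)

theorem summable_norm_of_ramanujanHypothesis {a : ℕ → ℂ} (ha : RamanujanHypothesis a)
    (p : Nat.Primes) {x : ℂ} (hx : 1 < ‖x‖) :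
    Summable fun k => ‖a ((p : ℕ) ^ k) * x⁻¹ ^ k‖ := by
  -- Taking `ε = log_p β` gives `(p ^ k) ^ ε = β ^ k`, half of the available decay `β ^ (-2k)`; a
  -- geometric series of ratio `β⁻¹` remains.
  set β := √‖x‖ with hβ
  have hβ1 : 1 < β := Real.lt_sqrt_of_sq_lt (by simpa using hx)
  have hβ2 : β * β = ‖x‖ := Real.mul_self_sqrt (norm_nonneg _)
  have hp1 : (1 : ℝ) < (p : ℕ) := by exact_mod_cast p.2.one_lt
  have hε := ha (Real.logb (p : ℕ) β) (Real.logb_pos hp1 hβ1)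
  have hO := (hε.comp_tendsto (tendsto_pow_atTop_atTop_of_one_lt p.2.one_lt)).norm_left.mul
    (isBigO_refl (fun k : ℕ => ‖x⁻¹ ^ k‖) atTop)
  have hgeom : Summable fun k : ℕ => β⁻¹ ^ k :=
    summable_geometric_of_lt_one (by positivity) (inv_lt_one_of_one_lt₀ hβ1)
  refine summable_of_isBigO_nat hgeom ((hO.congr_left fun k => (norm_mul _ _).symm).trans
    (IsBigO.of_bound 1 ?_))
  refine Eventually.of_forall fun k => ?_
  have h1 : (((p : ℕ) ^ k : ℕ) : ℝ) ^ Real.logb (p : ℕ) β = β ^ k := by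
    rw [Nat.cast_pow, ← Real.rpow_natCast, ← Real.rpow_mul (by positivity), mul_comm,
      Real.rpow_mul (by positivity), Real.rpow_logb (by linarith) hp1.ne' (by linarith),
      Real.rpow_natCast]
  have h2 : β * ‖x⁻¹‖ = β⁻¹ := by
    rw [norm_inv, ← hβ2]
    field_simp
  simp only [Function.comp_apply]
  rw [h1, one_mul, ← h2, mul_pow, norm_mul, norm_mul, norm_norm, norm_pow x⁻¹, norm_pow ‖x⁻¹‖,
    norm_norm]

/-- Each term of the sum at `s = 2` is at most `2 ^ K ≤ p ^ K`, and `p ^ 2` clears the denominator.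
This crude bound gives each completely multiplicative factor a half-plane of absolute convergence.
-/
theorem exists_norm_le_pow_of_summable {m : ℕ} {α : Nat.Primes → Fin m → ℂ}
    (hs : Summable fun p : Nat.Primes => ∑ j, ‖α p j / ((p : ℕ) : ℂ) ^ (2 : ℂ)‖) :
    ∃ K : ℕ, ∀ j, ∀ p : Nat.Primes, ‖α p j‖ ≤ ((p : ℕ) : ℝ) ^ K := by
  obtain ⟨K, hK⟩ := pow_unbounded_of_one_lt
    (∑' p : Nat.Primes, ∑ j, ‖α p j / ((p : ℕ) : ℂ) ^ (2 : ℂ)‖) one_lt_two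
  refine ⟨K + 2, fun j p => ?_⟩
  have h1 : ‖α p j / ((p : ℕ) : ℂ) ^ (2 : ℂ)‖ ≤ 2 ^ K :=
    (Finset.single_le_sum (f := fun j => ‖α p j / ((p : ℕ) : ℂ) ^ (2 : ℂ)‖)
      (fun j _ => norm_nonneg _) (Finset.mem_univ j)).trans
      ((hs.le_tsum p fun q _ => Finset.sum_nonneg fun j _ => norm_nonneg _).trans hK.le)
  have hp0 : (0 : ℝ) < (p : ℕ) := by exact_mod_cast p.2.pos
  have hp2 : (2 : ℝ) ≤ (p : ℕ) := by exact_mod_cast p.2.two_le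
  have h2 : ((p : ℕ) : ℂ) ^ (2 : ℂ) = ((p : ℕ) : ℂ) ^ 2 := by
    exact_mod_cast cpow_natCast ((p : ℕ) : ℂ) 2
  rw [h2, norm_div, norm_pow, norm_natCast, div_le_iff₀ (by positivity)] at h1
  rw [pow_add]
  exact h1.trans (by gcongr)

/-- Expansion of a polynomial Euler product as a Dirichlet convolution of completely
multiplicative functions. -/
theorem coeff_eq_prod_completelyMultiplicativeAF {a : ℕ → ℂ} {L : ℂ → ℂ} {m : ℕ}
    (hL : IsDirichletSeries a L) {α : Nat.Primes → Fin m → ℂ}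
    (hα : ∀ s : ℂ, 1 < s.re →
      Summable (fun p : Nat.Primes => ∑ j, ‖α p j / ((p : ℕ) : ℂ) ^ s‖) ∧
      HasProd (fun p : Nat.Primes => ∏ j, (1 - α p j / ((p : ℕ) : ℂ) ^ s)⁻¹) (L s))
    {n : ℕ} (hn : n ≠ 0) : a n = (∏ j, completelyMultiplicativeAF fun p => α p j) n := by
  obtain ⟨K, hK⟩ := exists_norm_le_pow_of_summable (hα 2 (by norm_num)).1
  have hprod : ∀ s : ℂ, K + 1 < s.re → LSeriesHasSum
      (∏ j, completelyMultiplicativeAF fun p => α p j : ArithmeticFunction ℂ) s (L s) := by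
    intro s hs
    have hs1 : 1 < s.re := by linarith [(K.cast_nonneg : (0 : ℝ) ≤ K)]
    have hs0 : s ≠ 0 := fun h => by
      rw [h, zero_re] at hs1
      linarith
    have hsum := fun j => LSeriesSummable_completelyMultiplicative (hK j) hs
    have h1 := hasProd_prod (s := Finset.univ)
      fun j _ => hasProd_completelyMultiplicative hs0 (hsum j)
    rw [(hα s hs1).2.unique h1]
    exact LSeriesHasSum_prod _ fun j _ => (hsum j).LSeriesHasSum
  -- Agreement for large real `s` suffices, by uniqueness of Dirichlet coefficients; hence any `K`
  -- will do.
  refine LSeries.eq_of_LSeries_eventually_eq ?_ ?_ ?_ hn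
  · exact (hL 2 (by norm_num)).LSeriesSummable.abscissaOfAbsConv_le.trans_lt (EReal.coe_lt_top _)
  · have hK2 : (K + 1 : ℝ) < ((K + 2 : ℝ) : ℂ).re := by
      rw [ofReal_re]
      linarith
    exact (hprod _ hK2).LSeriesSummable.abscissaOfAbsConv_le.trans_lt (EReal.coe_lt_top _)
  · filter_upwards [eventually_gt_atTop (K + 1 : ℝ)] with x hx
    have hx1 : 1 < x := by linarith [(K.cast_nonneg : (0 : ℝ) ≤ K)]
    exact (hL x (by simpa using hx1)).LSeries_eq.trans (hprod x (by simpa using hx)).LSeries_eq.symm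

/-- Under the Ramanujan hypothesis, the local parameters of a polynomial Euler product are at
most `1` in absolute value. -/
theorem norm_le_one_of_ramanujanHypothesis {a : ℕ → ℂ} {m : ℕ} (ha : RamanujanHypothesis a)
    {α : Nat.Primes → Fin m → ℂ}
    (hcoeff : ∀ n ≠ 0, a n = (∏ j, completelyMultiplicativeAF fun p => α p j) n)
    (j : Fin m) (p : Nat.Primes) : ‖α p j‖ ≤ 1 := by
  by_contra! hlt
  have hinv : primePowerSeries p (∏ j, completelyMultiplicativeAF fun p => α p j) *
      ((∏ j, (1 - Polynomial.C (α p j) * Polynomial.X) : Polynomial ℂ) : PowerSeries ℂ) = 1 := by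
    rw [map_prod, ← Polynomial.coeToPowerSeries.ringHom_apply, map_prod, ← Finset.prod_mul_distrib]
    exact Finset.prod_eq_one fun j _ =>
      primePowerSeries_completelyMultiplicativeAF_mul (fun p => α p j) p
  -- If `‖α p j‖ > 1`, its inverse is a root of the local polynomial inside the disc of absolute
  -- convergence.
  refine eval_ne_zero_of_powerSeries_mul_eq_one hinv (x := (α p j)⁻¹) ?_ ?_
  · simp_rw [coeff_primePowerSeries, ← hcoeff _ (pow_ne_zero _ p.2.ne_zero)]
    exact summable_norm_of_ramanujanHypothesis ha p hlt
  · rw [Polynomial.eval_prod]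
    refine Finset.prod_eq_zero (Finset.mem_univ j) ?_
    have hne : α p j ≠ 0 := norm_pos_iff.1 (by linarith)
    simp [hne]

/-- A Dirichlet series with a polynomial Euler product of order `m` satisfying the Ramanujan
hypothesis has coefficients bounded by `d_m(n)`. -/
theorem HasPolynomialEulerProduct.norm_coeff_le {a : ℕ → ℂ} {L : ℂ → ℂ} {m : ℕ}
    (h : HasPolynomialEulerProduct L m) (hL : IsDirichletSeries a L) (ha : RamanujanHypothesis a)
    {n : ℕ} (hn : 1 ≤ n) : ‖a n‖ ≤ generalDivisor m n := by
  obtain ⟨-, α, hα⟩ := h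
  have hcoeff := fun n hn => coeff_eq_prod_completelyMultiplicativeAF hL hα (n := n) hn
  rw [hcoeff n (by omega)]
  refine norm_prod_le_generalDivisor _ (fun j n _ => ?_) n
  have h1 : ∀ p : Nat.Primes, ‖α p j‖ ≤ ((p : ℕ) : ℝ) ^ 0 := fun p =>
    (norm_le_one_of_ramanujanHypothesis ha hcoeff j p).trans_eq (pow_zero _).symm
  exact (norm_completelyMultiplicative_le h1 n).trans_eq (pow_zero _)

/-! ### Conclusion -/

theorem GrowthOnOneLine.mono {L : ℂ → ℂ} {ℓ ℓ' : ℝ} (h : GrowthOnOneLine L ℓ) (hℓ : ℓ ≤ ℓ') :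
    GrowthOnOneLine L ℓ' := by
  refine ⟨h.1.trans_le hℓ, h.2.trans (IsBigO.of_bound 1 ?_)⟩
  filter_upwards [tendsto_norm_cocompact_atTop.eventually_ge_atTop (Real.exp 1)] with t ht
  rw [Real.norm_eq_abs] at ht
  have h1 : 1 ≤ Real.log |t| := (Real.le_log_iff_exp_le ((Real.exp_pos 1).trans_le ht)).2 ht
  rw [Real.norm_of_nonneg (by positivity), Real.norm_of_nonneg (by positivity), one_mul]
  exact Real.rpow_le_rpow_of_exponent_le h1 hℓ

theorem theorem2p1 :
    (∀ (a : ℕ → ℂ) (L : ℂ → ℂ) (m : ℕ), InClassG a L m →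
      ∀ ε : ℝ, 0 < ε → GrowthOnOneLine L ((m : ℝ) + ε)) ∧
    (∀ (a : ℕ → ℂ) (L : ℂ → ℂ), InSelbergClass a L →
      ∀ α : ℕ, 1 ≤ α → (∃ C : ℝ, ∀ n : ℕ, 1 ≤ n → ‖a n‖ ≤ C * (generalDivisor α n : ℝ)) →
        GrowthOnOneLine L (α : ℝ)) ∧
    (∀ (a : ℕ → ℂ) (L : ℂ → ℂ) (m : ℕ), InSelbergClassPoly a L m →
      GrowthOnOneLine L (m : ℝ)) := by
  refine ⟨fun a L m h ε hε => ?_, fun a L h α hα ⟨C, hC⟩ => ?_, fun a L m h => ?_⟩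
  -- The exponent `m` itself is reached here; `ε` enters only by monotonicity.
  · have h1 : GrowthOnOneLine L m :=
      growthOnOneLine_of_coeff_le_generalDivisor h.dirichletSeries h.continuation h.eulerProduct.1
        (C := 1) (fun n hn => (one_mul (generalDivisor m n : ℝ)).symm ▸
          h.eulerProduct.norm_coeff_le h.dirichletSeries h.ramanujan hn)
        fun _ => h.growth.isBigO_left_line
    exact h1.mono (le_add_of_nonneg_right hε.le)
  · exact growthOnOneLine_of_coeff_le_generalDivisor h.dirichletSeries h.continuation hα hC
      h.functionalEquation.isBigO_left_line
  · exact growthOnOneLine_of_coeff_le_generalDivisor h.dirichletSeries h.continuation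
      h.eulerProduct.1 (C := 1) (fun n hn => (one_mul (generalDivisor m n : ℝ)).symm ▸
        h.eulerProduct.norm_coeff_le h.dirichletSeries h.ramanujan hn)
      h.functionalEquation.isBigO_left_line
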